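/- Let $(\mathcal{C},\mathbb{E},\mathfrak{s})$ be an extriangulated category in the sense of Nakaoka and Palu, satisfying Condition (WIC): if $gf$ is an inflation then so is $f$, and if $gf$ is a deflation then so is $g$. Let $\xi$ be a proper class of $\mathbb{E}$-triangles in $\mathcal{C}$, that is, a class of $\mathbb{E}$-triangles closed under isomorphisms and finite coproducts, containing all split $\mathbb{E}$-triangles, closed under base change and cobase change, and saturated. (Saturated means: for $\mathbb{E}$-triangles $A_i\xrightarrow{x_i}B_i\xrightarrow{y_i}C\overset{\delta_i}{\dashrightarrow}$, $i=1,2$, and a commutative diagram given by $m_1\colon A_1\to M$, $e_1\colon M\to B_2$, $m_2\colon A_2\to M$, $e_2\colon M\to B_1$ with $e_1m_2=x_2$, $e_2m_1=x_1$, $y_2e_1=y_1e_2$, $\mathfrak{s}(y_2^*\delta_1)=[A_1\xrightarrow{m_1}M\xrightarrow{e_1}B_2]$ and $\mathfrak{s}(y_1^*\delta_2)=[A_2\xrightarrow{m_2}M\xrightarrow{e_2}B_1]$: if $A_2\to B_2\to C\overset{\delta_2}{\dashrightarrow}$ and $A_1\to M\to B_2\overset{y_2^*\delta_1}{\dashrightarrow}$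 are in $\xi$, then so is $A_1\to B_1\to C\overset{\delta_1}{\dashrightarrow}$.) Assume that $\mathcal{C}$ has enough $\xi$-projectives and enough $\xi$-injectives, where $P$ is $\xi$-projective (resp. $I$ is $\xi$-injective) if $0\to\mathcal{C}(P,A)\to\mathcal{C}(P,B)\to\mathcal{C}(P,C)\to0$ (resp. $0\to\mathcal{C}(C,I)\to\mathcal{C}(B,I)\to\mathcal{C}(A,I)\to0$) is exact for every $\mathbb{E}$-triangle $A\to B\to C\dashrightarrow$ in $\xi$; that is, for every object $A$ there are $\mathbb{E}$-triangles $K\to P\to A\dashrightarrow$ and $A\to I\to K'\dashrightarrow$ in $\xi$ with $P$ $\xi$-projective and $I$ $\xi$-injective. Let $\mathcal{W}$ be a class of objects of $\mathcal{C}$ that is closed under isomorphisms and finite direct sums. An $\mathbb{E}$-triangle $A\to B\to C\dashrightarrow$ in $\xi$ is called $\mathcal{C}(\mathcal{W},-)$-exact (resp. $\mathcal{C}(-,\mathcal{W})$-exact) if for every $W\in\mathcal{W}$ the sequence $0\to\mathcal{C}(W,A)\to\mathcal{C}(W,B)\to\mathcal{C}(W,C)\to0$ (resp. $0\to\mathcal{C}(C,W)\to\mathcal{C}(B,W)\to\mathcal{C}(A,W)\to0$)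 of abelian groups is exact. The Gorenstein subcategory $\mathcal{GW}(\xi)$ consists of the objects $G$ that admit a complete $\mathcal{W}(\xi)$-resolution: a complex $\cdots\to W_1\xrightarrow{d_1}W_0\xrightarrow{d_0}W_{-1}\to\cdots$ with all $W_n\in\mathcal{W}$, together with $\mathbb{E}$-triangles $K_{n+1}\xrightarrow{g_n}W_n\xrightarrow{f_n}K_n\dashrightarrow$ in $\xi$ for all $n\in\mathbb{Z}$, each both $\mathcal{C}(\mathcal{W},-)$-exact and $\mathcal{C}(-,\mathcal{W})$-exact, such that $d_n=g_{n-1}f_n$ for all $n$ and $K_0\cong G$. Let $X\to Y\to Z\dashrightarrow$ be an $\mathbb{E}$-triangle in $\xi$ that is both $\mathcal{C}(\mathcal{W},-)$-exact and $\mathcal{C}(-,\mathcal{W})$-exact, and suppose that $Y\in\mathcal{GW}(\xi)$. Then $X\in\mathcal{GW}(\xi)$ if and only if $Z\in\mathcal{GW}(\xi)$. -/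

import Mathlib

open CategoryTheory CategoryTheory.Limits Opposite

universe w v u

namespace Extri

section Bifunctor

variable {C : Type u} [Category.{v} C] (E : Cᵒᵖ ⥤ C ⥤ AddCommGrpCat.{w})

/-- The abelian group `𝔼(Z, A)`; its elements are the `𝔼`-extensions. -/
abbrev Ext (Z A : C) : Type w := (E.obj (op Z)).obj A

variable {E}

/-- `a_* δ`. -/
def push {Z A A' : C} (a : A ⟶ A') (δ : Ext E Z A) : Ext E Z A' :=
  ((E.obj (op Z)).map a).hom δ

/-- `c^* δ`. -/
def pull {Z Z' A : C} (c : Z' ⟶ Z) (δ : Ext E Z A) : Ext E Z' A :=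
  ((E.map c.op).app A).hom δ

/-- `δ ⊕ δ'`, the element of `𝔼(Z ⊕ Z', A ⊕ A')` that corresponds to `(δ, 0, 0, δ')` under
additivity of `𝔼`. -/
noncomputable def dsum [Preadditive C] [HasBinaryBiproducts C] {Z A Z' A' : C}
    (δ : Ext E Z A) (δ' : Ext E Z' A') : Ext E (Z ⊞ Z') (A ⊞ A') :=
  push biprod.inl (pull biprod.fst δ) + push biprod.inr (pull biprod.snd δ')

end Bifunctor

section Sequences

variable {C : Type u} [Category.{v} C]

/-- A sequence `A ⟶ B ⟶ Z` with fixed end terms. -/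
structure Seq (A Z : C) where
  mid : C
  i : A ⟶ mid
  p : mid ⟶ Z

/-- Two sequences are equivalent if there is an isomorphism of the middle terms that is
compatible with the identities of the end terms. -/
def seqSetoid (A Z : C) : Setoid (Seq A Z) where
  r S T := ∃ b : S.mid ≅ T.mid, S.i ≫ b.hom = T.i ∧ b.hom ≫ T.p = S.p
  iseqv :=
    { refl := fun S => ⟨Iso.refl _, by simp, by simp⟩
      symm := by
        rintro S T ⟨b, h₁, h₂⟩
        exact ⟨b.symm, by simp [← h₁], by simp [← h₂]⟩
      trans := by
        rintro S T U ⟨b, h₁, h₂⟩ ⟨b', h₁', h₂'⟩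
        exact ⟨b ≪≫ b', by simp [← h₁', ← h₁], by simp [← h₂, ← h₂']⟩ }

/-- A correspondence `𝔰` that sends every `𝔼`-extension `δ ∈ 𝔼(Z, A)` to an equivalence class
of sequences `A ⟶ B ⟶ Z`. -/
abbrev Correspondence (E : Cᵒᵖ ⥤ C ⥤ AddCommGrpCat.{w}) :=
  ∀ ⦃A Z : C⦄, Ext E Z A → Quotient (seqSetoid A Z)

/-- `𝔰(δ) = [A ⟶ B ⟶ Z]`. -/
def Realizes {E : Cᵒᵖ ⥤ C ⥤ AddCommGrpCat.{w}} (s : Correspondence E) {A B Z : C}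
    (x : A ⟶ B) (y : B ⟶ Z) (δ : Ext E Z A) : Prop :=
  s δ = Quotient.mk (seqSetoid A Z) ⟨B, x, y⟩

end Sequences

/-- An extriangulated structure (in the sense of Nakaoka and Palu) on an additive category. -/
structure ExtriangulatedStructure (C : Type u) [Category.{v} C] [Preadditive C]
    [HasZeroObject C] [HasBinaryBiproducts C] where
  /-- the bifunctor `𝔼` -/
  E : Cᵒᵖ ⥤ C ⥤ AddCommGrpCat.{w}
  /-- (ET1): `𝔼` is additive in each variable -/
  additive_left : E.Additive
  additive_right : ∀ Z : Cᵒᵖ, (E.obj Z).Additive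
  /-- the correspondence `𝔰` -/
  s : Correspondence E
  /-- (ET2): `𝔰` is a realization -/
  realization : ∀ {A B Z A' B' Z' : C} {x : A ⟶ B} {y : B ⟶ Z} {δ : Ext E Z A}
    {x' : A' ⟶ B'} {y' : B' ⟶ Z'} {δ' : Ext E Z' A'},
    Realizes s x y δ → Realizes s x' y' δ' →
    ∀ (a : A ⟶ A') (c : Z ⟶ Z'), push a δ = pull c δ' →
      ∃ b : B ⟶ B', x ≫ b = a ≫ x' ∧ y ≫ c = b ≫ y'
  /-- (ET2): `𝔰` is additive -/
  realizes_zero : ∀ A Z : C,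
    Realizes s (biprod.inl : A ⟶ A ⊞ Z) (biprod.snd : A ⊞ Z ⟶ Z) (0 : Ext E Z A)
  realizes_dsum : ∀ {A B Z A' B' Z' : C} {x : A ⟶ B} {y : B ⟶ Z} {δ : Ext E Z A}
    {x' : A' ⟶ B'} {y' : B' ⟶ Z'} {δ' : Ext E Z' A'},
    Realizes s x y δ → Realizes s x' y' δ' →
    Realizes s (biprod.map x x') (biprod.map y y') (dsum δ δ')
  /-- (ET3) -/
  et3 : ∀ {A B Z A' B' Z' : C} {x : A ⟶ B} {y : B ⟶ Z} {δ : Ext E Z A}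
    {x' : A' ⟶ B'} {y' : B' ⟶ Z'} {δ' : Ext E Z' A'},
    Realizes s x y δ → Realizes s x' y' δ' →
    ∀ (a : A ⟶ A') (b : B ⟶ B'), x ≫ b = a ≫ x' →
      ∃ c : Z ⟶ Z', y ≫ c = b ≫ y' ∧ push a δ = pull c δ'
  /-- (ET3)ᵒᵖ -/
  et3_op : ∀ {A B Z A' B' Z' : C} {x : A ⟶ B} {y : B ⟶ Z} {δ : Ext E Z A}
    {x' : A' ⟶ B'} {y' : B' ⟶ Z'} {δ' : Ext E Z' A'},
    Realizes s x y δ → Realizes s x' y' δ' →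
    ∀ (b : B ⟶ B') (c : Z ⟶ Z'), y ≫ c = b ≫ y' →
      ∃ a : A ⟶ A', x ≫ b = a ≫ x' ∧ push a δ = pull c δ'
  /-- (ET4) -/
  et4 : ∀ {A B D M F : C} {f : A ⟶ B} {f' : B ⟶ D} {δ : Ext E D A}
    {g : B ⟶ M} {g' : M ⟶ F} {δ' : Ext E F B},
    Realizes s f f' δ → Realizes s g g' δ' →
    ∃ (N : C) (h' : M ⟶ N) (d : D ⟶ N) (e : N ⟶ F) (δ'' : Ext E N A),
      f' ≫ d = g ≫ h' ∧ h' ≫ e = g' ∧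
      Realizes s (f ≫ g) h' δ'' ∧
      Realizes s d e (push f' δ') ∧
      pull d δ'' = δ ∧
      push f δ'' = pull e δ'
  /-- (ET4)ᵒᵖ -/
  et4_op : ∀ {D M B F Z : C} {f' : D ⟶ M} {f : M ⟶ B} {δ : Ext E B D}
    {g' : F ⟶ B} {g : B ⟶ Z} {δ' : Ext E Z F},
    Realizes s f' f δ → Realizes s g' g δ' →
    ∃ (N : C) (d : D ⟶ N) (e : N ⟶ F) (h' : N ⟶ M) (δ'' : Ext E Z N),
      d ≫ h' = f' ∧ h' ≫ f = e ≫ g' ∧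
      Realizes s h' (f ≫ g) δ'' ∧
      Realizes s d e (pull g' δ) ∧
      push e δ'' = δ' ∧
      push d δ = pull g δ''

section Exactness

variable {C : Type u} [Category.{v} C] [Preadditive C]

/-- The sequence `0 ⟶ C(P, A) ⟶ C(P, B) ⟶ C(P, Z) ⟶ 0` is exact. -/
def HomFromExact (P : C) {A B Z : C} (x : A ⟶ B) (y : B ⟶ Z) : Prop :=
  Function.Injective (fun t : P ⟶ A => t ≫ x) ∧
  Function.Exact (fun t : P ⟶ A => t ≫ x) (fun t : P ⟶ B => t ≫ y) ∧
  Function.Surjective (fun t : P ⟶ B => t ≫ y)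

/-- The sequence `0 ⟶ C(Z, I) ⟶ C(B, I) ⟶ C(A, I) ⟶ 0` is exact. -/
def HomToExact (I : C) {A B Z : C} (x : A ⟶ B) (y : B ⟶ Z) : Prop :=
  Function.Injective (fun t : Z ⟶ I => y ≫ t) ∧
  Function.Exact (fun t : Z ⟶ I => y ≫ t) (fun t : B ⟶ I => x ≫ t) ∧
  Function.Surjective (fun t : B ⟶ I => x ≫ t)

/-- `C(𝒲, -)`-exactness of `A ⟶ B ⟶ Z`. -/
def ExactFromClass (W : ObjectProperty C) {A B Z : C} (x : A ⟶ B) (y : B ⟶ Z) : Prop :=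
  ∀ P : C, W P → HomFromExact P x y

/-- `C(-, 𝒲)`-exactness of `A ⟶ B ⟶ Z`. -/
def ExactToClass (W : ObjectProperty C) {A B Z : C} (x : A ⟶ B) (y : B ⟶ Z) : Prop :=
  ∀ I : C, W I → HomToExact I x y

end Exactness

variable {C : Type u} [Category.{v} C] [Preadditive C] [HasZeroObject C] [HasBinaryBiproducts C]

namespace ExtriangulatedStructure

variable (𝒞 : ExtriangulatedStructure.{w} C)

/-- `A ⟶ B ⟶ Z` together with `δ ∈ 𝔼(Z, A)` is an `𝔼`-triangle. -/
def IsETriangle {A B Z : C} (x : A ⟶ B) (y : B ⟶ Z) (δ : Ext 𝒞.E Z A) : Prop :=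
  Realizes 𝒞.s x y δ

def IsInflation {A B : C} (x : A ⟶ B) : Prop :=
  ∃ (Z : C) (y : B ⟶ Z) (δ : Ext 𝒞.E Z A), 𝒞.IsETriangle x y δ

def IsDeflation {B Z : C} (y : B ⟶ Z) : Prop :=
  ∃ (A : C) (x : A ⟶ B) (δ : Ext 𝒞.E Z A), 𝒞.IsETriangle x y δ

/-- Condition (WIC). -/
structure WIC : Prop where
  inflation : ∀ {A B Z : C} (f : A ⟶ B) (g : B ⟶ Z), 𝒞.IsInflation (f ≫ g) → 𝒞.IsInflation f
  deflation : ∀ {A B Z : C} (f : A ⟶ B) (g : B ⟶ Z), 𝒞.IsDeflation (f ≫ g) → 𝒞.IsDeflation g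

/-- A class of triples `(x, y, δ)`; see `IsProperClass.isETriangle` for the requirement that
its members are `𝔼`-triangles. -/
abbrev TriangleClass :=
  ∀ ⦃A B Z : C⦄, (A ⟶ B) → (B ⟶ Z) → Ext 𝒞.E Z A → Prop

variable {𝒞}

/-- `ξ` is a proper class of `𝔼`-triangles. -/
structure IsProperClass (ξ : 𝒞.TriangleClass) : Prop where
  isETriangle : ∀ {A B Z : C} {x : A ⟶ B} {y : B ⟶ Z} {δ : Ext 𝒞.E Z A},
    ξ x y δ → 𝒞.IsETriangle x y δ
  of_iso : ∀ {A B Z A' B' Z' : C} {x : A ⟶ B} {y : B ⟶ Z} {δ : Ext 𝒞.E Z A}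
    {x' : A' ⟶ B'} {y' : B' ⟶ Z'} {δ' : Ext 𝒞.E Z' A'} (a : A ≅ A') (b : B ≅ B') (c : Z ≅ Z'),
    x ≫ b.hom = a.hom ≫ x' → y ≫ c.hom = b.hom ≫ y' → push a.hom δ = pull c.hom δ' →
    𝒞.IsETriangle x' y' δ' → ξ x y δ → ξ x' y' δ'
  /-- closure under finite coproducts (the empty coproduct is a split `𝔼`-triangle) -/
  biprod : ∀ {A B Z A' B' Z' : C} {x : A ⟶ B} {y : B ⟶ Z} {δ : Ext 𝒞.E Z A}
    {x' : A' ⟶ B'} {y' : B' ⟶ Z'} {δ' : Ext 𝒞.E Z' A'},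
    ξ x y δ → ξ x' y' δ' → ξ (biprod.map x x') (biprod.map y y') (dsum δ δ')
  split : ∀ {A B Z : C} {x : A ⟶ B} {y : B ⟶ Z},
    𝒞.IsETriangle x y (0 : Ext 𝒞.E Z A) → ξ x y (0 : Ext 𝒞.E Z A)
  baseChange : ∀ {A B Z B' Z' : C} {x : A ⟶ B} {y : B ⟶ Z} {δ : Ext 𝒞.E Z A} (c : Z' ⟶ Z)
    {x' : A ⟶ B'} {y' : B' ⟶ Z'},
    ξ x y δ → 𝒞.IsETriangle x' y' (pull c δ) → ξ x' y' (pull c δ)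
  cobaseChange : ∀ {A B Z A' B' : C} {x : A ⟶ B} {y : B ⟶ Z} {δ : Ext 𝒞.E Z A} (a : A ⟶ A')
    {x' : A' ⟶ B'} {y' : B' ⟶ Z},
    ξ x y δ → 𝒞.IsETriangle x' y' (push a δ) → ξ x' y' (push a δ)
  saturated : ∀ {A₁ B₁ A₂ B₂ Z M : C} {x₁ : A₁ ⟶ B₁} {y₁ : B₁ ⟶ Z} {δ₁ : Ext 𝒞.E Z A₁}
    {x₂ : A₂ ⟶ B₂} {y₂ : B₂ ⟶ Z} {δ₂ : Ext 𝒞.E Z A₂}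
    {m₁ : A₁ ⟶ M} {e₁ : M ⟶ B₂} {m₂ : A₂ ⟶ M} {e₂ : M ⟶ B₁},
    𝒞.IsETriangle x₁ y₁ δ₁ → 𝒞.IsETriangle x₂ y₂ δ₂ →
    𝒞.IsETriangle m₁ e₁ (pull y₂ δ₁) → 𝒞.IsETriangle m₂ e₂ (pull y₁ δ₂) →
    m₂ ≫ e₁ = x₂ → m₁ ≫ e₂ = x₁ → e₁ ≫ y₂ = e₂ ≫ y₁ →
    ξ x₂ y₂ δ₂ → ξ m₁ e₁ (pull y₂ δ₁) → ξ x₁ y₁ δ₁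

def IsXiProjective (ξ : 𝒞.TriangleClass) (P : C) : Prop :=
  ∀ {A B Z : C} {x : A ⟶ B} {y : B ⟶ Z} {δ : Ext 𝒞.E Z A}, ξ x y δ → HomFromExact P x y

def IsXiInjective (ξ : 𝒞.TriangleClass) (I : C) : Prop :=
  ∀ {A B Z : C} {x : A ⟶ B} {y : B ⟶ Z} {δ : Ext 𝒞.E Z A}, ξ x y δ → HomToExact I x y

def EnoughXiProjectives (ξ : 𝒞.TriangleClass) : Prop :=
  ∀ A : C, ∃ (K P : C) (x : K ⟶ P) (y : P ⟶ A) (δ : Ext 𝒞.E A K),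
    ξ x y δ ∧ IsXiProjective ξ P

def EnoughXiInjectives (ξ : 𝒞.TriangleClass) : Prop :=
  ∀ A : C, ∃ (I K : C) (x : A ⟶ I) (y : I ⟶ K) (δ : Ext 𝒞.E K A),
    ξ x y δ ∧ IsXiInjective ξ I

/-- `𝔼`-triangles `K (n+1) ⟶ X n ⟶ K n` in `ξ` through which the differentials of the complex
`X` factor. A complex is `ξ`-exact if such a family exists. -/
structure XiExactData (ξ : 𝒞.TriangleClass) (X : ChainComplex C ℤ) where
  K : ℤ → C
  g : ∀ n : ℤ, K (n + 1) ⟶ X.X n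
  f : ∀ n : ℤ, X.X n ⟶ K n
  δ : ∀ n : ℤ, Ext 𝒞.E (K n) (K (n + 1))
  mem : ∀ n : ℤ, ξ (g n) (f n) (δ n)
  d_eq : ∀ n : ℤ, X.d (n + 1) n = f (n + 1) ≫ g n

/-- A complete `𝒲(ξ)`-resolution of `G`: a complex with terms in `𝒲` that is spliced from
`𝔼`-triangles `K (n+1) ⟶ X n ⟶ K n` in `ξ` which are both `C(𝒲, -)`-exact and
`C(-, 𝒲)`-exact, with `G` as the term `K 0`, so that the `𝔼`-triangles for `n = 0` and `n = -1`
are `K 1 ⟶ X 0 ⟶ G` and `G ⟶ X (-1) ⟶ K (-1)`. -/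
structure CompleteResolution (ξ : 𝒞.TriangleClass) (W : ObjectProperty C) (G : C) where
  X : ChainComplex C ℤ
  mem : ∀ n : ℤ, W (X.X n)
  data : XiExactData ξ X
  exactFrom : ∀ n : ℤ, ExactFromClass W (data.g n) (data.f n)
  exactTo : ∀ n : ℤ, ExactToClass W (data.g n) (data.f n)
  iso : data.K 0 ≅ G

/-- The Gorenstein subcategory `𝒢𝒲(ξ)`. -/
def Gorenstein (ξ : 𝒞.TriangleClass) (W : ObjectProperty C) : ObjectProperty C :=
  fun G => Nonempty (CompleteResolution ξ W G)

end ExtriangulatedStructure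

end Extri

/-!
Write `𝓟` for the class of objects that lie in `W` or are `ξ`-projective. An `𝔼`-triangle lies in `ξ`
as soon as morphisms from `ξ`-projectives lift along its deflation, since it is then a cobase change
of a triangle `K ⟶ P ⟶ Z` in `ξ` with `P` projective (`IsProperClass.mem_of_exactFrom`). Hence the
triangles of `ξ` that are exact for `C(W, -)` and `C(-, W)` are exactly the `𝔼`-triangles that are
`C(𝓟, -)`-exact and `C(-, W)`-exact. The class `ξ` disappears, and the notion left is a
`RelConflation` for two classes of objects, which is self-dual.

By (ET4) and its dual, relative conflations are stable under composition of inflations and of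
deflations (`RelConflation.comp_inflation_aux`, `RelConflation.comp_deflation_aux`). They also admit
homotopy cartesian squares: if `A ⟶ V` extends along `A ⟶ N`, then `A ⟶ N ⟶ B` and `A ⟶ V ⟶ Q` give
a conflation `N ⟶ V ⊞ B ⟶ Q` (`RelConflation.exists_to_biprod`), and dually.

Gorenstein objects form the largest class whose members all have a syzygy and a cosyzygy in the
class (`RelGorenstein.of_forall_exists`), so that resolutions never have to be spliced by hand. With
the two facts above, the middle terms of conflations between Gorenstein objects form such a class;
this is closure under extensions (`RelGorenstein.of_extension`).

Now let `X ⟶ Y ⟶ Z` be a conflation with `Y` and `Z` Gorenstein. Composing `X ⟶ Y` with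
`Y ⟶ V ⟶ Y'` gives a cosyzygy of `X` that is an extension of `Y'` by `Z`. For a syzygy of `X`, take
`Z' ⟶ V₀ ⟶ Z`. Then `X ⊞ V₀` is an extension of `Y` by `Z'`, hence Gorenstein, and if
`M' ⟶ V₁ ⟶ X ⊞ V₀` is a conflation with `V₁` in `W` and `M'` Gorenstein, the kernel of the composite
`V₁ ⟶ X ⊞ V₀ ⟶ X` is an extension of `V₀` by `M'`. So `X` is Gorenstein
(`RelGorenstein.of_deflation`), and the other implication is dual.
-/

namespace Extri

/-! ### Functoriality of `𝔼`-extensions -/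

section Bifunctor

variable {C : Type u} [Category.{v} C] {E : Cᵒᵖ ⥤ C ⥤ AddCommGrpCat.{w}}

@[simp]
lemma push_id {Z A : C} (δ : Ext E Z A) : push (𝟙 A) δ = δ := by simp [push]

@[simp]
lemma pull_id {Z A : C} (δ : Ext E Z A) : pull (𝟙 Z) δ = δ := by simp [pull]

lemma push_push {Z A A' A'' : C} (a : A ⟶ A') (a' : A' ⟶ A'') (δ : Ext E Z A) :
    push a' (push a δ) = push (a ≫ a') δ := by simp [push]

lemma pull_pull {Z Z' Z'' A : C} (c : Z' ⟶ Z) (c' : Z'' ⟶ Z') (δ : Ext E Z A) :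
    pull c' (pull c δ) = pull (c' ≫ c) δ := by simp [pull]

lemma push_pull {Z Z' A A' : C} (a : A ⟶ A') (c : Z' ⟶ Z) (δ : Ext E Z A) :
    push a (pull c δ) = pull c (push a δ) := by
  simp [push, pull]

@[simp]
lemma push_zero {Z A A' : C} (a : A ⟶ A') : push a (0 : Ext E Z A) = 0 := by simp [push]

@[simp]
lemma pull_zero {Z Z' A : C} (c : Z' ⟶ Z) : pull c (0 : Ext E Z A) = 0 := by simp [pull]

lemma dsum_zero_right [Preadditive C] [HasBinaryBiproducts C] {Z A Z' A' : C} (δ : Ext E Z A) :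
    dsum δ (0 : Ext E Z' A') = push biprod.inl (pull biprod.fst δ) := by simp [dsum]

lemma dsum_zero_left [Preadditive C] [HasBinaryBiproducts C] {Z A Z' A' : C} (δ' : Ext E Z' A') :
    dsum (0 : Ext E Z A) δ' = push biprod.inr (pull biprod.snd δ') := by simp [dsum]

end Bifunctor

section Sequences

variable {C : Type u} [Category.{v} C] {E : Cᵒᵖ ⥤ C ⥤ AddCommGrpCat.{w}} {s : Correspondence E}

lemma exists_realizes (s : Correspondence E) {A Z : C} (δ : Ext E Z A) :
    ∃ (B : C) (x : A ⟶ B) (y : B ⟶ Z), Realizes s x y δ := by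
  obtain ⟨⟨B, x, y⟩, h⟩ := Quotient.exists_rep (s δ)
  exact ⟨B, x, y, h.symm⟩

lemma Realizes.exists_iso {A B B' Z : C} {x : A ⟶ B} {y : B ⟶ Z} {x' : A ⟶ B'} {y' : B' ⟶ Z}
    {δ : Ext E Z A} (h : Realizes s x y δ) (h' : Realizes s x' y' δ) :
    ∃ b : B ≅ B', x ≫ b.hom = x' ∧ b.hom ≫ y' = y :=
  Quotient.exact (h.symm.trans h')

lemma Realizes.of_iso_mid {A B B' Z : C} {x : A ⟶ B} {y : B ⟶ Z} {x' : A ⟶ B'} {y' : B' ⟶ Z}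
    {δ : Ext E Z A} (h : Realizes s x y δ) (b : B ≅ B') (hx : x ≫ b.hom = x')
    (hy : b.hom ≫ y' = y) : Realizes s x' y' δ :=
  h.trans (Quotient.sound ⟨b, hx, hy⟩)

end Sequences

variable {C : Type u} [Category.{v} C] [Preadditive C] [HasZeroObject C] [HasBinaryBiproducts C]

namespace ExtriangulatedStructure

open scoped ZeroObject

variable {𝒞 : ExtriangulatedStructure.{w} C}

/-! ### Exactness properties of `𝔼`-triangles -/

namespace IsETriangle

section Exactness

variable {A B Z : C} {x : A ⟶ B} {y : B ⟶ Z} {δ : Ext 𝒞.E Z A} (h : 𝒞.IsETriangle x y δ)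
include h

lemma comp_eq_zero : x ≫ y = 0 := by
  obtain ⟨c, hc, -⟩ := 𝒞.et3 (𝒞.realizes_zero A Z) h (𝟙 A) (biprod.fst ≫ x) (by simp)
  simpa using (biprod.inl ≫= hc).symm

lemma exists_lift {P : C} (t : P ⟶ B) (ht : t ≫ y = 0) : ∃ r : P ⟶ A, r ≫ x = t := by
  obtain ⟨a, ha, -⟩ := 𝒞.et3_op (𝒞.realizes_zero P P) h (biprod.fst ≫ t) 0 (by simp [ht])
  exact ⟨a, by simpa using ha.symm⟩

lemma exists_desc {I : C} (t : B ⟶ I) (ht : x ≫ t = 0) : ∃ r : Z ⟶ I, y ≫ r = t := by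
  obtain ⟨c, hc, -⟩ := 𝒞.et3 h (𝒞.realizes_zero I I) 0 (t ≫ biprod.inr) (by simp [reassoc_of% ht])
  exact ⟨c, by simpa using hc⟩

lemma pull_eq_zero : pull y δ = 0 := by
  obtain ⟨c, hc, hc'⟩ := 𝒞.et3 (𝒞.realizes_zero A B) h (𝟙 A) (biprod.desc x (𝟙 B)) (by simp)
  have : c = y := by simpa using biprod.inr ≫= hc
  simpa [this] using hc'.symm

lemma push_eq_zero : push x δ = 0 := by
  obtain ⟨a, ha, ha'⟩ := 𝒞.et3_op h (𝒞.realizes_zero B Z) (biprod.lift (𝟙 B) y) (𝟙 Z) (by simp)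
  have : a = x := by simpa using (ha =≫ biprod.fst).symm
  simpa [this] using ha'

lemma exists_lift_of_pull_eq_zero {P : C} (c : P ⟶ Z) (hc : pull c δ = 0) :
    ∃ t : P ⟶ B, t ≫ y = c := by
  obtain ⟨b, -, hb⟩ := 𝒞.realization (𝒞.realizes_zero A P) h (𝟙 A) c (by simp [hc])
  exact ⟨biprod.inr ≫ b, by simp [← hb]⟩

lemma exists_desc_of_push_eq_zero {I : C} (a : A ⟶ I) (ha : push a δ = 0) :
    ∃ t : B ⟶ I, x ≫ t = a := by
  obtain ⟨b, hb, -⟩ := 𝒞.realization h (𝒞.realizes_zero I Z) a (𝟙 Z) (by simp [ha])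
  exact ⟨b ≫ biprod.fst, by simp [reassoc_of% hb]⟩

end Exactness

/-- The five lemma: the middle component of a morphism of `𝔼`-triangles is invertible if the outer
components are. -/
lemma isIso_mid {A B Z A' B' Z' : C} {x : A ⟶ B} {y : B ⟶ Z} {δ : Ext 𝒞.E Z A} {x' : A' ⟶ B'}
    {y' : B' ⟶ Z'} {δ' : Ext 𝒞.E Z' A'} (h : 𝒞.IsETriangle x y δ) (h' : 𝒞.IsETriangle x' y' δ')
    (a : A ≅ A') (b : B ⟶ B') (c : Z ≅ Z') (hx : x ≫ b = a.hom ≫ x') (hy : y ≫ c.hom = b ≫ y')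
    (hδ : push a.hom δ = pull c.hom δ') : IsIso b := by
  have hδ₁ : δ = pull c.hom (push a.inv δ') := by
    rw [← push_pull, ← hδ, push_push, a.hom_inv_id, push_id]
  have hδ₂ : δ' = push a.hom (pull c.inv δ) := by
    rw [push_pull, hδ, pull_pull, c.inv_hom_id, pull_id]
  obtain ⟨s, hs⟩ : ∃ s : B' ⟶ B, s ≫ b = 𝟙 B' := by
    obtain ⟨s, hs⟩ := h.exists_lift_of_pull_eq_zero (y' ≫ c.inv) (by
      rw [hδ₁, pull_pull, Category.assoc, c.inv_hom_id, Category.comp_id, ← push_pull,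
        h'.pull_eq_zero, push_zero])
    obtain ⟨r, hr⟩ := h'.exists_lift (𝟙 B' - s ≫ b) (by simp [← hy, reassoc_of% hs])
    exact ⟨s + r ≫ a.inv ≫ x, by simp [hx, hr]⟩
  obtain ⟨t, ht⟩ : ∃ t : B' ⟶ B, b ≫ t = 𝟙 B := by
    obtain ⟨t, ht⟩ := h'.exists_desc_of_push_eq_zero (a.inv ≫ x) (by
      rw [hδ₂, push_push, a.hom_inv_id_assoc, push_pull, h.push_eq_zero, pull_zero])
    obtain ⟨r, hr⟩ := h.exists_desc (𝟙 B - b ≫ t) (by simp [reassoc_of% hx, ht])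
    exact ⟨t + y' ≫ c.inv ≫ r, by simp [← reassoc_of% hy, hr]⟩
  have : t = s := by rw [← Category.id_comp t, ← hs, Category.assoc, ht, Category.comp_id]
  exact ⟨s, this ▸ ht, hs⟩

lemma of_iso_left {A A' B Z : C} {x : A ⟶ B} {y : B ⟶ Z} {δ : Ext 𝒞.E Z A}
    (h : 𝒞.IsETriangle x y δ) (a : A ≅ A') : 𝒞.IsETriangle (a.inv ≫ x) y (push a.hom δ) := by
  obtain ⟨B', x', y', h'⟩ := exists_realizes 𝒞.s (push a.hom δ)
  obtain ⟨b, hb, hb'⟩ := 𝒞.realization h h' a.hom (𝟙 Z) (by simp)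
  have := isIso_mid h h' a b (Iso.refl Z) hb hb' (by simp)
  exact h'.of_iso_mid (asIso b).symm (by simp [← cancel_mono b, hb]) (by simpa using hb')

lemma of_iso_right {A B Z Z' : C} {x : A ⟶ B} {y : B ⟶ Z} {δ : Ext 𝒞.E Z A}
    (h : 𝒞.IsETriangle x y δ) (c : Z ≅ Z') : 𝒞.IsETriangle x (y ≫ c.hom) (pull c.inv δ) := by
  obtain ⟨B', x', y', h'⟩ := exists_realizes 𝒞.s (pull c.inv δ)
  have hδ : push (𝟙 A) δ = pull c.hom (pull c.inv δ) := by simp [pull_pull]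
  obtain ⟨b, hb, hb'⟩ := 𝒞.realization h h' (𝟙 A) c.hom hδ
  have := isIso_mid h h' (Iso.refl A) b c hb hb' hδ
  exact h'.of_iso_mid (asIso b).symm (by simp [← cancel_mono b, hb]) (by simp [hb'])

/-- A biproduct diagram is an `𝔼`-triangle with trivial extension. -/
lemma of_splitting {A B Z : C} (i : A ⟶ B) (p : B ⟶ Z) (r : B ⟶ A) (s : Z ⟶ B)
    (hir : i ≫ r = 𝟙 A) (hsp : s ≫ p = 𝟙 Z) (hip : i ≫ p = 0) (hsr : s ≫ r = 0)
    (hid : r ≫ i + p ≫ s = 𝟙 B) : 𝒞.IsETriangle i p 0 :=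
  Realizes.of_iso_mid (𝒞.realizes_zero A Z)
    { hom := biprod.desc i s
      inv := biprod.lift r p
      hom_inv_id := by ext <;> simp [*]
      inv_hom_id := by simpa using hid }
    (by simp) (by ext <;> simp [*])

/-- The biproduct of `A ⟶ B ⟶ Z` with `0 ⟶ D ⟶ D`. -/
lemma biprod_id_right {A B Z : C} {x : A ⟶ B} {y : B ⟶ Z} {δ : Ext 𝒞.E Z A}
    (h : 𝒞.IsETriangle x y δ) (D : C) :
    𝒞.IsETriangle (x ≫ (biprod.inl : B ⟶ B ⊞ D)) (biprod.map y (𝟙 D)) (pull biprod.fst δ) := by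
  have h₀ : 𝒞.IsETriangle (0 : (0 : C) ⟶ D) (𝟙 D) 0 :=
    of_splitting _ _ 0 (𝟙 D) (by ext) (by simp) (by simp) (by simp) (by simp)
  have h₁ := (of_iso_left (𝒞.realizes_dsum h h₀) (isoBiprodZero (isZero_zero C)).symm)
  rw [dsum_zero_right, push_push] at h₁
  simpa using h₁

/-- The biproduct of `A ⟶ B ⟶ Z` with `D ⟶ D ⟶ 0`. -/
lemma biprod_id_left {A B Z : C} {x : A ⟶ B} {y : B ⟶ Z} {δ : Ext 𝒞.E Z A}
    (h : 𝒞.IsETriangle x y δ) (D : C) :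
    𝒞.IsETriangle (biprod.map (𝟙 D) x) ((biprod.snd : D ⊞ B ⟶ B) ≫ y) (push biprod.inr δ) := by
  have h₀ : 𝒞.IsETriangle (𝟙 D) (0 : D ⟶ (0 : C)) 0 :=
    of_splitting _ _ (𝟙 D) 0 (by simp) (by ext) (by simp) (by simp) (by simp)
  have h₁ := (of_iso_right (𝒞.realizes_dsum h₀ h) (isoZeroBiprod (isZero_zero C)).symm)
  rw [dsum_zero_left, ← push_pull, pull_pull] at h₁
  simpa using h₁

end IsETriangle

/-! ### Conflations relative to two classes of objects -/

variable (𝒞) in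
/-- `x` and `y` are the morphisms of an `𝔼`-triangle that is `C(𝓟, -)`-exact and `C(-, 𝓘)`-exact.
The extension itself is not part of the data. -/
structure RelConflation (𝓟 𝓘 : ObjectProperty C) {A B Z : C} (x : A ⟶ B) (y : B ⟶ Z) : Prop where
  exists_isETriangle : ∃ δ : Ext 𝒞.E Z A, 𝒞.IsETriangle x y δ
  exactFrom : ExactFromClass 𝓟 x y
  exactTo : ExactToClass 𝓘 x y

namespace RelConflation

variable {𝓟 𝓘 : ObjectProperty C}

/-- Exactness in the middle is automatic for an `𝔼`-triangle, and injectivity may be tested on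
morphisms with composite zero. -/
lemma mk' {A B Z : C} {x : A ⟶ B} {y : B ⟶ Z} {δ : Ext 𝒞.E Z A} (h : 𝒞.IsETriangle x y δ)
    (hx : ∀ P, 𝓟 P → ∀ t : P ⟶ A, t ≫ x = 0 → t = 0)
    (hy : ∀ P, 𝓟 P → ∀ t : P ⟶ Z, ∃ r : P ⟶ B, r ≫ y = t)
    (hy' : ∀ I, 𝓘 I → ∀ t : Z ⟶ I, y ≫ t = 0 → t = 0)
    (hx' : ∀ I, 𝓘 I → ∀ t : A ⟶ I, ∃ r : B ⟶ I, x ≫ r = t) :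
    𝒞.RelConflation 𝓟 𝓘 x y where
  exists_isETriangle := ⟨δ, h⟩
  exactFrom P hP := by
    refine ⟨fun t t' htt => ?_, fun t => ⟨h.exists_lift t, ?_⟩, hy P hP⟩
    · exact sub_eq_zero.1 (hx P hP _ (by simpa [sub_eq_zero] using htt))
    · rintro ⟨r, rfl⟩
      simp [h.comp_eq_zero]
  exactTo I hI := by
    refine ⟨fun t t' htt => ?_, fun t => ⟨h.exists_desc t, ?_⟩, hx' I hI⟩
    · exact sub_eq_zero.1 (hy' I hI _ (by simpa [sub_eq_zero] using htt))
    · rintro ⟨r, rfl⟩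
      simp [reassoc_of% h.comp_eq_zero]

section

variable {A B Z : C} {x : A ⟶ B} {y : B ⟶ Z} (h : 𝒞.RelConflation 𝓟 𝓘 x y)
include h

lemma comp_eq_zero : x ≫ y = 0 := h.exists_isETriangle.choose_spec.comp_eq_zero

lemma eq_zero_of_comp {P : C} (hP : 𝓟 P) (t : P ⟶ A) (ht : t ≫ x = 0) : t = 0 :=
  (h.exactFrom P hP).1 (by simpa using ht)

lemma exists_lift {P : C} (hP : 𝓟 P) (t : P ⟶ Z) : ∃ r : P ⟶ B, r ≫ y = t :=
  (h.exactFrom P hP).2.2 t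

lemma eq_zero_of_comp' {I : C} (hI : 𝓘 I) (t : Z ⟶ I) (ht : y ≫ t = 0) : t = 0 :=
  (h.exactTo I hI).1 (by simpa using ht)

lemma exists_desc {I : C} (hI : 𝓘 I) (t : A ⟶ I) : ∃ r : B ⟶ I, x ≫ r = t :=
  (h.exactTo I hI).2.2 t

lemma of_iso_left {A' : C} (a : A ≅ A') : 𝒞.RelConflation 𝓟 𝓘 (a.inv ≫ x) y := by
  obtain ⟨δ, hδ⟩ := h.exists_isETriangle
  refine mk' (hδ.of_iso_left a) (fun P hP t ht => ?_) (fun P hP => h.exists_lift hP)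
    (fun I hI => h.eq_zero_of_comp' hI) (fun I hI t => ?_)
  · have := h.eq_zero_of_comp hP (t ≫ a.inv) (by simpa using ht)
    simpa using this
  · obtain ⟨r, hr⟩ := h.exists_desc hI (a.hom ≫ t)
    exact ⟨r, by simp [hr]⟩

lemma of_iso_right {Z' : C} (c : Z ≅ Z') : 𝒞.RelConflation 𝓟 𝓘 x (y ≫ c.hom) := by
  obtain ⟨δ, hδ⟩ := h.exists_isETriangle
  refine mk' (hδ.of_iso_right c) (fun P hP => h.eq_zero_of_comp hP) (fun P hP t => ?_)
    (fun I hI t ht => ?_) (fun I hI => h.exists_desc hI)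
  · obtain ⟨r, hr⟩ := h.exists_lift hP (t ≫ c.inv)
    exact ⟨r, by simp [reassoc_of% hr]⟩
  · have := h.eq_zero_of_comp' hI (c.hom ≫ t) (by simpa using ht)
    simpa using this

/-- The biproduct of `A ⟶ B ⟶ Z` with `0 ⟶ D ⟶ D`. -/
lemma biprod_id_right (D : C) :
    𝒞.RelConflation 𝓟 𝓘 (x ≫ (biprod.inl : B ⟶ B ⊞ D)) (biprod.map y (𝟙 D)) := by
  obtain ⟨δ, hδ⟩ := h.exists_isETriangle
  refine mk' (hδ.biprod_id_right D) (fun P hP t ht => ?_) (fun P hP t => ?_)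
    (fun I hI t ht => ?_) (fun I hI t => ?_)
  · exact h.eq_zero_of_comp hP t (by simpa using ht =≫ biprod.fst)
  · obtain ⟨r, hr⟩ := h.exists_lift hP (t ≫ biprod.fst)
    exact ⟨biprod.lift r (t ≫ biprod.snd), by ext <;> simp [hr]⟩
  · ext
    · simpa using h.eq_zero_of_comp' hI (biprod.inl ≫ t) (by simpa using biprod.inl ≫= ht)
    · simpa using biprod.inr ≫= ht
  · obtain ⟨r, hr⟩ := h.exists_desc hI t
    exact ⟨biprod.fst ≫ r, by simp [hr]⟩

/-- The biproduct of `A ⟶ B ⟶ Z` with `D ⟶ D ⟶ 0`. -/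
lemma biprod_id_left (D : C) :
    𝒞.RelConflation 𝓟 𝓘 (biprod.map (𝟙 D) x) ((biprod.snd : D ⊞ B ⟶ B) ≫ y) := by
  obtain ⟨δ, hδ⟩ := h.exists_isETriangle
  refine mk' (hδ.biprod_id_left D) (fun P hP t ht => ?_) (fun P hP t => ?_)
    (fun I hI t ht => ?_) (fun I hI t => ?_)
  · ext
    · simpa using ht =≫ biprod.fst
    · simpa using h.eq_zero_of_comp hP (t ≫ biprod.snd) (by simpa using ht =≫ biprod.snd)
  · obtain ⟨r, hr⟩ := h.exists_lift hP t
    exact ⟨r ≫ biprod.inr, by simp [hr]⟩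
  · exact h.eq_zero_of_comp' hI t (by simpa using biprod.inr ≫= ht)
  · obtain ⟨r, hr⟩ := h.exists_desc hI (biprod.inr ≫ t)
    exact ⟨biprod.desc (biprod.inl ≫ t) r, by ext <;> simp [hr]⟩

end

lemma of_splitting {A B Z : C} (i : A ⟶ B) (p : B ⟶ Z) (r : B ⟶ A) (s : Z ⟶ B)
    (hir : i ≫ r = 𝟙 A) (hsp : s ≫ p = 𝟙 Z) (hip : i ≫ p = 0) (hsr : s ≫ r = 0)
    (hid : r ≫ i + p ≫ s = 𝟙 B) : 𝒞.RelConflation 𝓟 𝓘 i p := by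
  refine mk' (IsETriangle.of_splitting i p r s hir hsp hip hsr hid) (fun P _ t ht => ?_)
    (fun P _ t => ⟨t ≫ s, by simp [hsp]⟩) (fun I _ t ht => ?_) (fun I _ t => ⟨r ≫ t, ?_⟩)
  · rw [← Category.comp_id t, ← hir, reassoc_of% ht, zero_comp]
  · rw [← Category.id_comp t, ← hsp, Category.assoc, ht, comp_zero]
  · rw [reassoc_of% hir]

/-- Conflations are stable under composition of inflations: for `A ⊆ B ⊆ M`, the sequences
`A ⟶ M ⟶ M / A` and `B / A ⟶ M / A ⟶ M / B` are again conflations. The last statement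
identifies `B / A ⟶ M / A ⟶ M / B` as a cobase change. -/
lemma comp_inflation_aux {A B D M F : C} {f : A ⟶ B} {f' : B ⟶ D} {g : B ⟶ M} {g' : M ⟶ F}
    {δ : Ext 𝒞.E D A} {δ' : Ext 𝒞.E F B}
    (h₁ : 𝒞.RelConflation 𝓟 𝓘 f f') (h₂ : 𝒞.RelConflation 𝓟 𝓘 g g')
    (hδ : 𝒞.IsETriangle f f' δ) (hδ' : 𝒞.IsETriangle g g' δ') :
    ∃ (N : C) (h' : M ⟶ N) (d : D ⟶ N) (e : N ⟶ F),
      𝒞.RelConflation 𝓟 𝓘 (f ≫ g) h' ∧ 𝒞.RelConflation 𝓟 𝓘 d e ∧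
      𝒞.IsETriangle d e (push f' δ') := by
  obtain ⟨N, h', d, e, δ'', hd, he, h₃, h₄, -, -⟩ := 𝒞.et4 hδ hδ'
  refine ⟨N, h', d, e, mk' h₃ (fun P hP t ht => ?_) (fun P hP t => ?_)
    (fun I hI t ht => ?_) (fun I hI t => ?_), mk' h₄ (fun P hP t ht => ?_) (fun P hP t => ?_)
    (fun I hI t ht => ?_) (fun I hI t => ?_), h₄⟩
  · exact h₁.eq_zero_of_comp hP t (h₂.eq_zero_of_comp hP _ (by simpa using ht))
  · obtain ⟨q, hq⟩ := h₂.exists_lift hP (t ≫ e)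
    obtain ⟨r, hr⟩ := IsETriangle.exists_lift h₄ (t - q ≫ h') (by simp [he, hq])
    obtain ⟨s, hs⟩ := h₁.exists_lift hP r
    exact ⟨q + s ≫ g, by simp [← hd, reassoc_of% hs, hr]⟩
  · obtain ⟨r, rfl⟩ := IsETriangle.exists_desc h₄ t
      (h₁.eq_zero_of_comp' hI _ (by rw [reassoc_of% hd, ht, comp_zero]))
    rw [h₂.eq_zero_of_comp' hI r (by simpa [reassoc_of% he] using ht), comp_zero]
  · obtain ⟨r, rfl⟩ := h₁.exists_desc hI t
    obtain ⟨s, rfl⟩ := h₂.exists_desc hI r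
    exact ⟨s, by simp⟩
  · obtain ⟨s, rfl⟩ := h₁.exists_lift hP t
    obtain ⟨r, hr⟩ := IsETriangle.exists_lift h₃ (s ≫ g) (by simpa [hd] using ht)
    have : s = r ≫ f := sub_eq_zero.1 (h₂.eq_zero_of_comp hP _ (by simp [hr]))
    simp [this, h₁.comp_eq_zero]
  · obtain ⟨r, hr⟩ := h₂.exists_lift hP t
    exact ⟨r ≫ h', by simp [he, hr]⟩
  · exact h₂.eq_zero_of_comp' hI t (by simp [← he, ht])
  · obtain ⟨m, hm⟩ := h₂.exists_desc hI (f' ≫ t)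
    obtain ⟨n, rfl⟩ := IsETriangle.exists_desc h₃ m
      (by simp [hm, reassoc_of% h₁.comp_eq_zero])
    refine ⟨n, sub_eq_zero.1 (h₁.eq_zero_of_comp' hI _ ?_)⟩
    simp [reassoc_of% hd, hm]

/-- Conflations are stable under composition of deflations: the dual of `comp_inflation_aux`. -/
lemma comp_deflation_aux {D M B F Z : C} {f' : D ⟶ M} {f : M ⟶ B} {g' : F ⟶ B} {g : B ⟶ Z}
    {δ : Ext 𝒞.E B D} {δ' : Ext 𝒞.E Z F}
    (h₁ : 𝒞.RelConflation 𝓟 𝓘 f' f) (h₂ : 𝒞.RelConflation 𝓟 𝓘 g' g)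
    (hδ : 𝒞.IsETriangle f' f δ) (hδ' : 𝒞.IsETriangle g' g δ') :
    ∃ (N : C) (d : D ⟶ N) (e : N ⟶ F) (h' : N ⟶ M),
      𝒞.RelConflation 𝓟 𝓘 h' (f ≫ g) ∧ 𝒞.RelConflation 𝓟 𝓘 d e ∧
      𝒞.IsETriangle d e (pull g' δ) := by
  obtain ⟨N, d, e, h', δ'', hd, he, h₃, h₄, -, -⟩ := 𝒞.et4_op hδ hδ'
  refine ⟨N, d, e, h', mk' h₃ (fun P hP t ht => ?_) (fun P hP t => ?_)
    (fun I hI t ht => ?_) (fun I hI t => ?_), mk' h₄ (fun P hP t ht => ?_) (fun P hP t => ?_)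
    (fun I hI t ht => ?_) (fun I hI t => ?_), h₄⟩
  · obtain ⟨r, rfl⟩ := IsETriangle.exists_lift h₄ t
      (h₂.eq_zero_of_comp hP _ (by rw [Category.assoc, ← he, reassoc_of% ht, zero_comp]))
    rw [h₁.eq_zero_of_comp hP r (by simpa [hd] using ht), zero_comp]
  · obtain ⟨r, rfl⟩ := h₂.exists_lift hP t
    obtain ⟨s, rfl⟩ := h₁.exists_lift hP r
    exact ⟨s, by simp⟩
  · exact h₂.eq_zero_of_comp' hI t (h₁.eq_zero_of_comp' hI _ (by simpa using ht))
  · obtain ⟨q, hq⟩ := h₁.exists_desc hI (d ≫ t)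
    obtain ⟨r, hr⟩ := IsETriangle.exists_desc h₄ (t - h' ≫ q) (by simp [reassoc_of% hd, hq])
    obtain ⟨s, hs⟩ := h₂.exists_desc hI r
    exact ⟨q + f ≫ s, by simp [reassoc_of% he, hs, hr]⟩
  · exact h₁.eq_zero_of_comp hP t (by rw [← hd, reassoc_of% ht, zero_comp])
  · obtain ⟨m, hm⟩ := h₁.exists_lift hP (t ≫ g')
    obtain ⟨n, rfl⟩ := IsETriangle.exists_lift h₃ m
      (by simp [reassoc_of% hm, h₂.comp_eq_zero])
    refine ⟨n, sub_eq_zero.1 (h₂.eq_zero_of_comp hP _ ?_)⟩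
    simp [← he, ← hm]
  · obtain ⟨s, rfl⟩ := h₂.exists_desc hI t
    obtain ⟨r, hr⟩ := IsETriangle.exists_desc h₃ (f ≫ s) (by simpa [reassoc_of% he] using ht)
    have : s = g ≫ r := sub_eq_zero.1 (h₁.eq_zero_of_comp' hI _ (by simp [← hr]))
    simp [this, reassoc_of% h₂.comp_eq_zero]
  · obtain ⟨r, hr⟩ := h₁.exists_desc hI t
    exact ⟨h' ≫ r, by simp [reassoc_of% hd, hr]⟩

lemma comp_inflation {A B D M F : C} {f : A ⟶ B} {f' : B ⟶ D} {g : B ⟶ M} {g' : M ⟶ F}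
    (h₁ : 𝒞.RelConflation 𝓟 𝓘 f f') (h₂ : 𝒞.RelConflation 𝓟 𝓘 g g') :
    ∃ (N : C) (h' : M ⟶ N) (d : D ⟶ N) (e : N ⟶ F),
      𝒞.RelConflation 𝓟 𝓘 (f ≫ g) h' ∧ 𝒞.RelConflation 𝓟 𝓘 d e := by
  obtain ⟨δ, hδ⟩ := h₁.exists_isETriangle
  obtain ⟨δ', hδ'⟩ := h₂.exists_isETriangle
  obtain ⟨N, h', d, e, h₃, h₄, -⟩ := comp_inflation_aux h₁ h₂ hδ hδ'
  exact ⟨N, h', d, e, h₃, h₄⟩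

lemma comp_deflation {D M B F Z : C} {f' : D ⟶ M} {f : M ⟶ B} {g' : F ⟶ B} {g : B ⟶ Z}
    (h₁ : 𝒞.RelConflation 𝓟 𝓘 f' f) (h₂ : 𝒞.RelConflation 𝓟 𝓘 g' g) :
    ∃ (N : C) (d : D ⟶ N) (e : N ⟶ F) (h' : N ⟶ M),
      𝒞.RelConflation 𝓟 𝓘 h' (f ≫ g) ∧ 𝒞.RelConflation 𝓟 𝓘 d e := by
  obtain ⟨δ, hδ⟩ := h₁.exists_isETriangle
  obtain ⟨δ', hδ'⟩ := h₂.exists_isETriangle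
  obtain ⟨N, d, e, h', h₃, h₄, -⟩ := comp_deflation_aux h₁ h₂ hδ hδ'
  exact ⟨N, d, e, h', h₃, h₄⟩

/-- If the inflation `w` extends along the inflation `x`, then `A ⟶ N ⟶ B` is a base change of
`A ⟶ V ⟶ Q` along some `B ⟶ Q`, and the homotopy cartesian square gives a conflation
`N ⟶ V ⊞ B ⟶ Q`. -/
lemma exists_to_biprod {A N B V Q : C} {x : A ⟶ N} {y : N ⟶ B} {w : A ⟶ V} {p : V ⟶ Q}
    (h : 𝒞.RelConflation 𝓟 𝓘 x y) (h' : 𝒞.RelConflation 𝓟 𝓘 w p) {e : N ⟶ V} (he : x ≫ e = w) :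
    ∃ (i : N ⟶ V ⊞ B) (q : V ⊞ B ⟶ Q), 𝒞.RelConflation 𝓟 𝓘 i q := by
  obtain ⟨δ, hδ⟩ := h.exists_isETriangle
  obtain ⟨δ', hδ'⟩ := h'.exists_isETriangle
  obtain ⟨c, -, hc⟩ := 𝒞.et3 hδ hδ' (𝟙 A) e (by simpa using he)
  -- `V ⊞ B ⟶ Q` is the composite of the deflations `V ⊞ B ⟶ Q ⊞ B` and `(1, c) : Q ⊞ B ⟶ Q`
  have h₂ : 𝒞.IsETriangle (biprod.lift c (-𝟙 B)) (biprod.desc (𝟙 Q) c) 0 :=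
    .of_splitting _ _ (-biprod.snd) biprod.inl (by simp) (by simp) (by simp) (by simp)
      (by ext <;> simp)
  have h₂' : 𝒞.RelConflation 𝓟 𝓘 (biprod.lift c (-𝟙 B)) (biprod.desc (𝟙 Q) c) :=
    .of_splitting _ _ (-biprod.snd) biprod.inl (by simp) (by simp) (by simp) (by simp)
      (by ext <;> simp)
  obtain ⟨N', d, e', k, h₃, -, h₄⟩ :=
    comp_deflation_aux (h'.biprod_id_right B) h₂' (hδ'.biprod_id_right B) h₂
  -- `A ⟶ N' ⟶ B` realizes the same extension as `A ⟶ N ⟶ B`, hence `N' ≅ N`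
  rw [pull_pull, biprod.lift_fst, ← hc, push_id] at h₄
  obtain ⟨b, -, -⟩ := Realizes.exists_iso h₄ hδ
  exact ⟨_, _, h₃.of_iso_left b⟩

/-- The dual of `exists_to_biprod`. -/
lemma exists_from_biprod {A N B V Q : C} {x : A ⟶ N} {y : N ⟶ B} {v : Q ⟶ V} {q : V ⟶ B}
    (h : 𝒞.RelConflation 𝓟 𝓘 x y) (h' : 𝒞.RelConflation 𝓟 𝓘 v q) {e : V ⟶ N} (he : e ≫ y = q) :
    ∃ (i : Q ⟶ A ⊞ V) (p : A ⊞ V ⟶ N), 𝒞.RelConflation 𝓟 𝓘 i p := by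
  obtain ⟨δ, hδ⟩ := h.exists_isETriangle
  obtain ⟨δ', hδ'⟩ := h'.exists_isETriangle
  obtain ⟨a, -, ha⟩ := 𝒞.et3_op hδ' hδ e (𝟙 B) (by simpa using he.symm)
  have h₂ : 𝒞.IsETriangle (biprod.lift a (𝟙 Q)) (biprod.desc (-𝟙 A) a) 0 :=
    .of_splitting _ _ biprod.snd (-biprod.inl) (by simp) (by simp) (by simp) (by simp)
      (by ext <;> simp)
  have h₂' : 𝒞.RelConflation 𝓟 𝓘 (biprod.lift a (𝟙 Q)) (biprod.desc (-𝟙 A) a) :=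
    .of_splitting _ _ biprod.snd (-biprod.inl) (by simp) (by simp) (by simp) (by simp)
      (by ext <;> simp)
  obtain ⟨N', k, d, e', h₃, -, h₄⟩ :=
    comp_inflation_aux h₂' (h'.biprod_id_left A) h₂ (hδ'.biprod_id_left A)
  rw [push_push, biprod.inr_desc, ha, pull_id] at h₄
  obtain ⟨b, -, -⟩ := Realizes.exists_iso h₄ hδ
  exact ⟨_, _, h₃.of_iso_right b⟩

end RelConflation

/-! ### Gorenstein objects of a relative conflation class -/

variable (𝒞) in
/-- `A` is a `W`-syzygy of `B`: there is a relative conflation `A ⟶ V ⟶ B` with `V` in `W`. -/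
def IsSyzygy (𝓟 𝓘 W : ObjectProperty C) (A B : C) : Prop :=
  ∃ (V : C) (i : A ⟶ V) (p : V ⟶ B), W V ∧ 𝒞.RelConflation 𝓟 𝓘 i p

variable (𝒞) in
/-- The objects `G` that are isomorphic to the term `K 0` of a doubly infinite sequence of
`W`-syzygies. -/
def RelGorenstein (𝓟 𝓘 W : ObjectProperty C) (G : C) : Prop :=
  ∃ K : ℤ → C, (∀ n, 𝒞.IsSyzygy 𝓟 𝓘 W (K (n + 1)) (K n)) ∧ Nonempty (K 0 ≅ G)

variable {𝓟 𝓘 W : ObjectProperty C}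

lemma IsSyzygy.of_iso {A B A' B' : C} (h : 𝒞.IsSyzygy 𝓟 𝓘 W A B) (a : A ≅ A') (b : B ≅ B') :
    𝒞.IsSyzygy 𝓟 𝓘 W A' B' := by
  obtain ⟨V, i, p, hV, h⟩ := h
  exact ⟨V, _, _, hV, (h.of_iso_left a).of_iso_right b⟩

namespace RelGorenstein

/-- Coinduction: an object is Gorenstein if it belongs to some class `S` such that each member of `S`
has a `W`-syzygy in `S` and is itself a `W`-syzygy of a member of `S`. -/
lemma of_forall_exists (S : C → Prop)
    (hl : ∀ G, S G → ∃ G', S G' ∧ 𝒞.IsSyzygy 𝓟 𝓘 W G' G)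
    (hr : ∀ G, S G → ∃ G', S G' ∧ 𝒞.IsSyzygy 𝓟 𝓘 W G G') {G : C} (hG : S G) :
    𝒞.RelGorenstein 𝓟 𝓘 W G := by
  choose l hl hl' using hl
  choose r hr hr' using hr
  let L : {G // S G} → {G // S G} := fun G => ⟨l G G.2, hl G G.2⟩
  let R : {G // S G} → {G // S G} := fun G => ⟨r G G.2, hr G G.2⟩
  let K : ℤ → {G // S G} := fun
    | .ofNat k => L^[k] ⟨G, hG⟩
    | .negSucc k => R^[k + 1] ⟨G, hG⟩
  refine ⟨fun n => (K n).1, fun n => ?_, ⟨Iso.refl _⟩⟩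
  match n with
  | .ofNat k =>
    change 𝒞.IsSyzygy 𝓟 𝓘 W (L^[k + 1] ⟨G, hG⟩).1 (L^[k] ⟨G, hG⟩).1
    rw [Function.iterate_succ_apply']
    exact hl' _ _
  | .negSucc 0 => exact hr' G hG
  | .negSucc (k + 1) =>
    change 𝒞.IsSyzygy 𝓟 𝓘 W (R^[k + 1] ⟨G, hG⟩).1 (R^[k + 1 + 1] ⟨G, hG⟩).1
    rw [Function.iterate_succ_apply' R (k + 1)]
    exact hr' _ _

/-- All terms of a doubly infinite sequence of syzygies are Gorenstein. -/
lemma of_sequence {K : ℤ → C} (hK : ∀ n, 𝒞.IsSyzygy 𝓟 𝓘 W (K (n + 1)) (K n)) (n : ℤ) :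
    𝒞.RelGorenstein 𝓟 𝓘 W (K n) := by
  refine of_forall_exists (fun G => ∃ n, K n = G) ?_ ?_ ⟨n, rfl⟩
  · rintro _ ⟨n, rfl⟩
    exact ⟨_, ⟨n + 1, rfl⟩, hK n⟩
  · rintro _ ⟨n, rfl⟩
    exact ⟨_, ⟨n - 1, rfl⟩, by simpa using hK (n - 1)⟩

lemma exists_isSyzygy_left {G : C} (hG : 𝒞.RelGorenstein 𝓟 𝓘 W G) :
    ∃ G', 𝒞.RelGorenstein 𝓟 𝓘 W G' ∧ 𝒞.IsSyzygy 𝓟 𝓘 W G' G := by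
  obtain ⟨K, hK, ⟨e⟩⟩ := hG
  exact ⟨_, of_sequence hK (0 + 1), (hK 0).of_iso (Iso.refl _) e⟩

lemma exists_isSyzygy_right {G : C} (hG : 𝒞.RelGorenstein 𝓟 𝓘 W G) :
    ∃ G', 𝒞.RelGorenstein 𝓟 𝓘 W G' ∧ 𝒞.IsSyzygy 𝓟 𝓘 W G G' := by
  obtain ⟨K, hK, ⟨e⟩⟩ := hG
  refine ⟨_, of_sequence hK (-1), IsSyzygy.of_iso (by simpa using hK (-1)) e (Iso.refl _)⟩

lemma of_isSyzygy {G' G G'' : C} (hl : 𝒞.RelGorenstein 𝓟 𝓘 W G') (h : 𝒞.IsSyzygy 𝓟 𝓘 W G' G)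
    (h' : 𝒞.IsSyzygy 𝓟 𝓘 W G G'') (hr : 𝒞.RelGorenstein 𝓟 𝓘 W G'') :
    𝒞.RelGorenstein 𝓟 𝓘 W G := by
  refine of_forall_exists (fun H => H = G ∨ 𝒞.RelGorenstein 𝓟 𝓘 W H) ?_ ?_ (Or.inl rfl)
  · rintro _ (rfl | hH)
    · exact ⟨_, Or.inr hl, h⟩
    · obtain ⟨H', hH', h⟩ := hH.exists_isSyzygy_left
      exact ⟨_, Or.inr hH', h⟩
  · rintro _ (rfl | hH)
    · exact ⟨_, Or.inr hr, h'⟩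
    · obtain ⟨H', hH', h⟩ := hH.exists_isSyzygy_right
      exact ⟨_, Or.inr hH', h⟩

/-- An object `V` of `W` is a syzygy of itself, by the split conflation `V ⟶ V ⊞ V ⟶ V`. -/
lemma of_mem (hWsum : ∀ {A B : C}, W A → W B → W (A ⊞ B)) {V : C} (hV : W V) :
    𝒞.RelGorenstein 𝓟 𝓘 W V :=
  ⟨fun _ => V, fun _ => ⟨V ⊞ V, _, _, hWsum hV hV,
    .of_splitting biprod.inl biprod.snd biprod.fst biprod.inr (by simp) (by simp) (by simp)
      (by simp) (by simp)⟩, ⟨Iso.refl V⟩⟩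

section

variable (hWP : W ≤ 𝓟) (hWI : W ≤ 𝓘) (hWsum : ∀ {A B : C}, W A → W B → W (A ⊞ B))
include hWP hWI hWsum

/-- Gorenstein objects are closed under extensions. This is the horseshoe lemma: syzygies and
cosyzygies of the end terms of a conflation give rise to ones of the middle term, which again
sit in a conflation. -/
lemma of_extension {A N B : C} {x : A ⟶ N} {y : N ⟶ B} (h : 𝒞.RelConflation 𝓟 𝓘 x y)
    (hA : 𝒞.RelGorenstein 𝓟 𝓘 W A) (hB : 𝒞.RelGorenstein 𝓟 𝓘 W B) :
    𝒞.RelGorenstein 𝓟 𝓘 W N := by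
  refine of_forall_exists (fun N => ∃ (A B : C) (x : A ⟶ N) (y : N ⟶ B),
    𝒞.RelConflation 𝓟 𝓘 x y ∧ 𝒞.RelGorenstein 𝓟 𝓘 W A ∧ 𝒞.RelGorenstein 𝓟 𝓘 W B)
    ?_ ?_ ⟨A, B, x, y, h, hA, hB⟩
  · rintro N ⟨A, B, x, y, h, hA, hB⟩
    obtain ⟨A', hA', VA, i, p, hVA, hp⟩ := hA.exists_isSyzygy_left
    obtain ⟨B', hB', VB, j, q, hVB, hq⟩ := hB.exists_isSyzygy_left
    obtain ⟨e, he⟩ := h.exists_lift (hWP _ hVB) q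
    obtain ⟨i', p', h'⟩ := h.exists_from_biprod hq he
    obtain ⟨N', d, e', k, h₁, h₂⟩ := (hp.biprod_id_right VB).comp_deflation h'
    exact ⟨N', ⟨A', B', d, e', h₂, hA', hB'⟩, _, _, _, hWsum hVA hVB, h₁⟩
  · rintro N ⟨A, B, x, y, h, hA, hB⟩
    obtain ⟨A', hA', VA, i, p, hVA, hi⟩ := hA.exists_isSyzygy_right
    obtain ⟨B', hB', VB, j, q, hVB, hj⟩ := hB.exists_isSyzygy_right
    obtain ⟨e, he⟩ := h.exists_desc (hWI _ hVA) i
    obtain ⟨i', p', h'⟩ := h.exists_to_biprod hi he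
    obtain ⟨N', k, d, e', h₁, h₂⟩ := h'.comp_inflation (hj.biprod_id_left VA)
    exact ⟨N', ⟨A', B', d, e', h₂, hA', hB'⟩, _, _, _, hWsum hVA hVB, h₁⟩

/-- The kernel of a deflation between Gorenstein objects is Gorenstein. -/
lemma of_deflation {X Y Z : C} {x : X ⟶ Y} {y : Y ⟶ Z} (h : 𝒞.RelConflation 𝓟 𝓘 x y)
    (hY : 𝒞.RelGorenstein 𝓟 𝓘 W Y) (hZ : 𝒞.RelGorenstein 𝓟 𝓘 W Z) :
    𝒞.RelGorenstein 𝓟 𝓘 W X := by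
  -- the cosyzygy of `X` is an extension of that of `Y` by `Z`
  obtain ⟨Y', hY', V, i, p, hV, hi⟩ := hY.exists_isSyzygy_right
  obtain ⟨N, k, d, e, h₁, h₂⟩ := h.comp_inflation hi
  -- `X ⊞ V₀` is an extension of `Y` by the syzygy of `Z`, and its syzygy yields one of `X`
  obtain ⟨Z', hZ', V₀, j, q, hV₀, hq⟩ := hZ.exists_isSyzygy_left
  obtain ⟨ℓ, hℓ⟩ := h.exists_lift (hWP _ hV₀) q
  obtain ⟨i', p', h₃⟩ := h.exists_from_biprod hq hℓ
  have hM : 𝒞.RelGorenstein 𝓟 𝓘 W (X ⊞ V₀) := of_extension hWP hWI hWsum h₃ hZ' hY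
  obtain ⟨M', hM', V₁, i₁, p₁, hV₁, h₄⟩ := hM.exists_isSyzygy_left
  have h₅ : 𝒞.RelConflation 𝓟 𝓘 (biprod.inr : V₀ ⟶ X ⊞ V₀) biprod.fst :=
    .of_splitting _ _ biprod.snd biprod.inl (by simp) (by simp) (by simp) (by simp)
      (by rw [add_comm, biprod.total])
  obtain ⟨T, d', e', k', h₆, h₇⟩ := h₄.comp_deflation h₅
  exact of_isSyzygy (of_extension hWP hWI hWsum h₇ hM' (of_mem hWsum hV₀))
    ⟨V₁, _, _, hV₁, h₆⟩ ⟨V, _, _, hV, h₁⟩ (of_extension hWP hWI hWsum h₂ hZ hY')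

/-- The cokernel of an inflation between Gorenstein objects is Gorenstein: the dual of
`of_deflation`. -/
lemma of_inflation {X Y Z : C} {x : X ⟶ Y} {y : Y ⟶ Z} (h : 𝒞.RelConflation 𝓟 𝓘 x y)
    (hX : 𝒞.RelGorenstein 𝓟 𝓘 W X) (hY : 𝒞.RelGorenstein 𝓟 𝓘 W Y) :
    𝒞.RelGorenstein 𝓟 𝓘 W Z := by
  obtain ⟨Y', hY', V, i, p, hV, hp⟩ := hY.exists_isSyzygy_left
  obtain ⟨N, d, e, k, h₁, h₂⟩ := hp.comp_deflation h
  obtain ⟨X', hX', V₀, j, q, hV₀, hj⟩ := hX.exists_isSyzygy_right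
  obtain ⟨ℓ, hℓ⟩ := h.exists_desc (hWI _ hV₀) j
  obtain ⟨i', p', h₃⟩ := h.exists_to_biprod hj hℓ
  have hM : 𝒞.RelGorenstein 𝓟 𝓘 W (V₀ ⊞ Z) := of_extension hWP hWI hWsum h₃ hY hX'
  obtain ⟨M', hM', V₁, i₁, p₁, hV₁, h₄⟩ := hM.exists_isSyzygy_right
  have h₅ : 𝒞.RelConflation 𝓟 𝓘 (biprod.inr : Z ⟶ V₀ ⊞ Z) biprod.fst :=
    .of_splitting _ _ biprod.snd biprod.inl (by simp) (by simp) (by simp) (by simp)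
      (by rw [add_comm, biprod.total])
  obtain ⟨T, k', d', e', h₆, h₇⟩ := h₅.comp_inflation h₄
  exact of_isSyzygy (of_extension hWP hWI hWsum h₂ hY' hX) ⟨V, _, _, hV, h₁⟩
    ⟨V₁, _, _, hV₁, h₆⟩ (of_extension hWP hWI hWsum h₇ (of_mem hWsum hV₀) hM')

end

end RelGorenstein

/-! ### Proper classes as relative conflation classes -/

/-- An `𝔼`-triangle belongs to `ξ` as soon as morphisms from `ξ`-projectives lift along its
deflation: it is then a cobase change of any triangle `K ⟶ P ⟶ Z` in `ξ` with `P` projective. -/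
lemma IsProperClass.mem_of_exactFrom {ξ : 𝒞.TriangleClass} (hξ : IsProperClass ξ)
    (hproj : EnoughXiProjectives ξ) {A B Z : C} {x : A ⟶ B} {y : B ⟶ Z} {δ : Ext 𝒞.E Z A}
    (h : 𝒞.IsETriangle x y δ) (hP : ExactFromClass (IsXiProjective ξ) x y) : ξ x y δ := by
  obtain ⟨K, P, i, p, ε, hε, hP'⟩ := hproj Z
  obtain ⟨t, ht⟩ := (hP P hP').2.2 p
  obtain ⟨a, -, ha⟩ := 𝒞.et3_op (hξ.isETriangle hε) h t (𝟙 Z) (by simpa using ht.symm)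
  rw [pull_id] at ha
  subst ha
  exact hξ.cobaseChange a hε h

lemma IsProperClass.relConflation_iff {ξ : 𝒞.TriangleClass} (hξ : IsProperClass ξ)
    (hproj : EnoughXiProjectives ξ) {A B Z : C} {x : A ⟶ B} {y : B ⟶ Z} :
    𝒞.RelConflation (W ⊔ IsXiProjective ξ) W x y ↔
      (∃ δ : Ext 𝒞.E Z A, ξ x y δ) ∧ ExactFromClass W x y ∧ ExactToClass W x y := by
  constructor
  · rintro ⟨⟨δ, hδ⟩, hf, ht⟩
    exact ⟨⟨δ, hξ.mem_of_exactFrom hproj hδ fun P hP => hf P (Or.inr hP)⟩,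
      fun P hP => hf P (Or.inl hP), ht⟩
  · rintro ⟨⟨δ, hδ⟩, hf, ht⟩
    refine ⟨⟨δ, hξ.isETriangle hδ⟩, ?_, ht⟩
    rintro P (hP | hP)
    · exact hf P hP
    · exact hP hδ

lemma IsProperClass.gorenstein_iff {ξ : 𝒞.TriangleClass} (hξ : IsProperClass ξ)
    (hproj : EnoughXiProjectives ξ) {G : C} :
    Gorenstein ξ W G ↔ 𝒞.RelGorenstein (W ⊔ IsXiProjective ξ) W W G := by
  constructor
  · rintro ⟨R⟩
    exact ⟨R.data.K, fun n => ⟨_, _, _, R.mem n, (hξ.relConflation_iff hproj).2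
      ⟨⟨_, R.data.mem n⟩, R.exactFrom n, R.exactTo n⟩⟩, ⟨R.iso⟩⟩
  · rintro ⟨K, hK, ⟨e⟩⟩
    choose V g f hV h using hK
    simp only [hξ.relConflation_iff hproj] at h
    choose δ hδ using fun n => (h n).1
    exact ⟨{
      X := ChainComplex.of V (fun n => f (n + 1) ≫ g n) fun n => by
        simp [reassoc_of% (hξ.isETriangle (hδ (n + 1))).comp_eq_zero]
      mem := hV
      data :=
        { K := K
          g := g
          f := f
          δ := δ
          mem := hδ
          d_eq := fun n => by simp }
      exactFrom := fun n => (h n).2.1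
      exactTo := fun n => (h n).2.2
      iso := e }⟩

end ExtriangulatedStructure
end Extri

theorem mainTheorem6 {C : Type u} [CategoryTheory.Category.{v} C] [CategoryTheory.Preadditive C]
    [CategoryTheory.Limits.HasZeroObject C] [CategoryTheory.Limits.HasBinaryBiproducts C]
    (𝒞 : Extri.ExtriangulatedStructure.{w} C) (hWIC : 𝒞.WIC)
    (ξ : 𝒞.TriangleClass) (hξ : Extri.ExtriangulatedStructure.IsProperClass ξ)
    (hproj : Extri.ExtriangulatedStructure.EnoughXiProjectives ξ)
    (hinj : Extri.ExtriangulatedStructure.EnoughXiInjectives ξ)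
    (W : CategoryTheory.ObjectProperty C)
    (hWiso : ∀ {A B : C}, (A ≅ B) → W A → W B)
    (hWsum : ∀ {A B : C}, W A → W B → W (A ⊞ B))
    {X Y Z : C} (x : X ⟶ Y) (y : Y ⟶ Z) (δ : Extri.Ext 𝒞.E Z X)
    (hδ : ξ x y δ)
    (hfrom : Extri.ExactFromClass W x y) (hto : Extri.ExactToClass W x y)
    (hY : Extri.ExtriangulatedStructure.Gorenstein ξ W Y) :
    Extri.ExtriangulatedStructure.Gorenstein ξ W X ↔
      Extri.ExtriangulatedStructure.Gorenstein ξ W Z := by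
  have h := (hξ.relConflation_iff hproj).2 ⟨⟨δ, hδ⟩, hfrom, hto⟩
  simp only [hξ.gorenstein_iff hproj] at hY ⊢
  exact ⟨fun hX => .of_inflation le_sup_left le_rfl hWsum h hX hY,
    fun hZ => .of_deflation le_sup_left le_rfl hWsum h hY hZ⟩
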